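/- On the triangular lattice with unit side and horizontal lattice lines, a \emph{lozenge} is the union of two unit triangles sharing an edge; it is \emph{vertical} if the shared edge is horizontal. Let $k\ge 1$ and $n\ge 0$ be integers. Consider the trapezoidal lattice region whose southern side has length $n+k$, whose northeastern side has length $2k-1$, whose northern side has length $n$, and whose western side is the vertical zigzag lattice path with $2k-1$ unit steps, going from the bottom to the top alternately in the north-east and the north-west direction (beginning and ending with a north-east step). Number the $n+k$ up-pointing unit triangles along the base $1,2,\dots,n+k$ from left to right, and, for integers $1\le a_1<a_2<\dots<a_k\le n+k$, remove those at the positions $a_1,\dots,a_k$. Give weight $\tfrac12$ to each vertical lozenge on the western side (that is, each vertical lozenge both of whose western sides lie on the zigzag path) and weight $1$ to every other lozenge, and call the resulting weighted region $\overline{L}_{2k-1,n}(a_1,\dots,a_k)$. Let $\operatorname{M}(\overline{L}_{2k-1,n}(a_1,\dots,a_k))$ be the sum, over all lozenge tilings of the region, of the product of the weights of the lozenges of the tiling. Then $$\operatorname{M}(\overline{L}_{2k-1,n}(a_1,\dots,a_k))=\frac{1}{\operatorname{H}_2(2k)}\prod_{1\le i<j\le k}(a_j-a_i)\prod_{1\le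 i<j\le k}(a_i+a_j-2),$$ where $\operatorname{H}_2(2k)=0!\,2!\,4!\cdots(2k-2)!$ and empty products equal $1$. -/

import Mathlib

/-!
# Lozenge tilings of weighted quartered hexagons

Points of the triangular lattice are written `(i, j) : ℤ × ℤ` in the oblique basis
`e₁ = (1, 0)`, `e₂ = (1/2, √3/2)`.  So `(i, j)` has height `j` (in units of `√3/2`) and
abscissa `i + j/2`.
-/

namespace Lozenge

/-- A unit triangle of the triangular lattice, with horizontal side.
`⟨i, j, true⟩` is the up-pointing triangle with base from `(i, j)` to `(i + 1, j)`;
`⟨i, j, false⟩` is the down-pointing triangle with upper side from `(i, j + 1)` to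
`(i + 1, j + 1)`. -/
abbrev Tri : Type := ℤ × ℤ × Bool

/-- The up-pointing unit triangle whose lower left vertex is `(i, j)`. -/
def up (i j : ℤ) : Tri := (i, j, true)

/-- The down-pointing unit triangle whose upper left vertex is `(i, j + 1)`. -/
def down (i j : ℤ) : Tri := (i, j, false)

/-- The three vertices of a unit triangle. -/
def vertices : Tri → Finset (ℤ × ℤ)
  | (i, j, true) => {(i, j), (i + 1, j), (i, j + 1)}
  | (i, j, false) => {(i + 1, j), (i, j + 1), (i + 1, j + 1)}

/-- A lozenge: the union of two unit triangles sharing an edge (that is, two vertices). -/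
def IsLozenge (L : Finset Tri) : Prop :=
  ∃ s t : Tri, (vertices s ∩ vertices t).card = 2 ∧ L = {s, t}

/-- `T` is a lozenge tiling of the region `R` (a finite set of unit triangles): a set of
lozenges contained in `R` that covers `R` without gaps or overlaps. -/
def IsTiling (R : Finset Tri) (T : Finset (Finset Tri)) : Prop :=
  (∀ L ∈ T, IsLozenge L ∧ L ⊆ R) ∧ ∀ t ∈ R, ∃! L, L ∈ T ∧ t ∈ L

open Classical in
/-- The finite set of all lozenge tilings of `R`. -/
noncomputable def tilings (R : Finset Tri) : Finset (Finset (Finset Tri)) :=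
  R.powerset.powerset.filter (IsTiling R)

theorem mem_tilings {R : Finset Tri} {T : Finset (Finset Tri)} :
    T ∈ tilings R ↔ IsTiling R T := by
  classical
  unfold tilings
  rw [Finset.mem_filter, Finset.mem_powerset]
  exact ⟨fun h => h.2, fun h =>
    ⟨fun L hL => Finset.mem_powerset.2 (h.1 L hL).2, h⟩⟩

/-- The weighted tiling count `M(R)`: the sum over all lozenge tilings of `R` of the product of
the weights of the lozenges. -/
noncomputable def weightedCount (R : Finset Tri) (wt : Finset Tri → ℚ) : ℚ :=
  ∑ T ∈ tilings R, ∏ L ∈ T, wt L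

/-- The point at height `j` of the vertical zigzag path that starts at the origin and
alternately goes one unit step to the north-east and one unit step to the north-west. Its
abscissa is `0` for even `j` and `1/2` for odd `j`. -/
def zigzag (j : ℤ) : ℤ × ℤ := (-(j / 2), j)

/-- The lattice points of the trapezoid with lower left corner at the origin, southern side of
length `n + k`, northeastern side of length `2k - 1`, northern side of length `n`, and western
side the zigzag path with `2k - 1` unit steps. -/
def InTrapezoid (k n : ℕ) (p : ℤ × ℤ) : Prop :=
  0 ≤ p.2 ∧ p.2 ≤ 2 * k - 1 ∧ (zigzag p.2).1 ≤ p.1 ∧ p.1 ≤ n + k - p.2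

instance (k n : ℕ) (p : ℤ × ℤ) : Decidable (InTrapezoid k n p) := by
  unfold InTrapezoid; infer_instance

/-- The trapezoid, as the set of its unit triangles. The box only makes finiteness
evident; see `mem_trapezoid`. -/
noncomputable def trapezoid (k n : ℕ) : Finset Tri :=
  (Finset.Icc (-(k : ℤ)) (n + k) ×ˢ Finset.Icc (0 : ℤ) (2 * k) ×ˢ Finset.univ).filter
    (fun t => ∀ p ∈ vertices t, InTrapezoid k n p)

theorem mem_trapezoid {k n : ℕ} {t : Tri} :
    t ∈ trapezoid k n ↔ ∀ p ∈ vertices t, InTrapezoid k n p := by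
  obtain ⟨i, j, b⟩ := t
  unfold trapezoid
  rw [Finset.mem_filter]
  refine ⟨fun h => h.2, fun h => ⟨?_, h⟩⟩
  cases b <;>
    simp only [vertices, InTrapezoid, zigzag, Finset.mem_insert, Finset.mem_singleton,
      forall_eq_or_imp, forall_eq, Finset.mem_product, Finset.mem_Icc, Finset.mem_univ,
      and_true] at h ⊢ <;>
    omega

/-- The quartered hexagon `L_{2k-1,n}(a₁, …, a_k)`: the trapezoid with the up-pointing unit
triangles at the positions `a₁, …, a_k` removed from its base. Position `p = 1, …, n + k`,
counted from the left, is the triangle with base from `(p - 1, 0)` to `(p, 0)`. -/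
noncomputable def quarteredHexagon (k n : ℕ) (a : Fin k → ℕ) : Finset Tri :=
  trapezoid k n \ Finset.univ.image (fun i => up ((a i : ℤ) - 1) 0)

/-- The lattice points of the western side of the trapezoid. -/
def OnWesternSide (k : ℕ) (p : ℤ × ℤ) : Prop :=
  0 ≤ p.2 ∧ p.2 ≤ 2 * k - 1 ∧ p = zigzag p.2

/-- A vertical lozenge on the western side. A vertical lozenge consists of two triangles sharing
a horizontal edge; if this edge is from `(i, j)` to `(i + 1, j)`, then the two western
sides of the lozenge run from `(i + 1, j - 1)` to `(i, j)` and from `(i, j)` to `(i, j + 1)`. -/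
def IsWesternVertical (k : ℕ) (L : Finset Tri) : Prop :=
  ∃ i j : ℤ, L = {up i j, down i (j - 1)} ∧
    OnWesternSide k (i + 1, j - 1) ∧ OnWesternSide k (i, j) ∧ OnWesternSide k (i, j + 1)

open Classical in
/-- The weight of a lozenge: `1/2` for a vertical lozenge on the western side, `1` otherwise. -/
noncomputable def weight (k : ℕ) (L : Finset Tri) : ℚ :=
  if IsWesternVertical k L then 1 / 2 else 1

/-- The skipping hyperfactorial: `0! 2! ⋯ (n-2)!` for even `n`, `1! 3! ⋯ (n-2)!` for odd `n`. -/
def H₂ : ℕ → ℕ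
  | 0 => 1
  | 1 => 1
  | n + 2 => H₂ n * n.factorial

end Lozenge

namespace Lozenge

/-- Two unit triangles are adjacent if they share an edge. -/
def Adj (s t : Tri) : Prop := (vertices s ∩ vertices t).card = 2

instance (s t : Tri) : Decidable (Adj s t) := by unfold Adj; infer_instance

theorem Adj.symm {s t : Tri} (h : Adj s t) : Adj t s := by
  unfold Adj at *; rwa [Finset.inter_comm]

theorem card_vertices (t : Tri) : (vertices t).card = 3 := by
  obtain ⟨i, j, b⟩ := t
  cases b <;> simp only [vertices] <;> rw [Finset.card_eq_three]
  · exact ⟨_, _, _, by simp, by simp, by simp, rfl⟩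
  · exact ⟨_, _, _, by simp, by simp, by simp, rfl⟩

theorem Adj.ne {s t : Tri} (h : Adj s t) : s ≠ t := by
  rintro rfl
  unfold Adj at h
  rw [Finset.inter_self, card_vertices] at h
  omega

theorem adj_up_iff {i j : ℤ} {t : Tri} :
    Adj (up i j) t ↔ t = down i j ∨ t = down (i - 1) j ∨ t = down i (j - 1) := by
  constructor
  · intro h
    have hne := h.ne
    have h2 : 1 < (vertices (up i j) ∩ vertices t).card := by unfold Adj at h; omega
    obtain ⟨⟨p1, p2⟩, hp, ⟨q1, q2⟩, hq, hpq⟩ := Finset.one_lt_card.1 h2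
    obtain ⟨i', j', b⟩ := t
    cases b <;>
      simp only [up, down, vertices, Finset.mem_inter, Finset.mem_insert, Finset.mem_singleton,
        Prod.mk.injEq, ne_eq, and_true] at hp hq hpq hne ⊢ <;> omega
  · have key : ∀ t p q, p ≠ q → vertices (up i j) ∩ vertices t = {p, q} → Adj (up i j) t := by
      intro t p q hpq h
      unfold Adj
      rw [h, Finset.card_pair hpq]
    rintro (rfl | rfl | rfl)
    · refine key _ (i + 1, j) (i, j + 1) (by simp) ?_
      ext ⟨p1, p2⟩
      simp only [up, down, vertices, Finset.mem_inter, Finset.mem_insert, Finset.mem_singleton,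
        Prod.mk.injEq]
      omega
    · refine key _ (i, j) (i, j + 1) (by simp) ?_
      ext ⟨p1, p2⟩
      simp only [up, down, vertices, Finset.mem_inter, Finset.mem_insert, Finset.mem_singleton,
        Prod.mk.injEq]
      omega
    · refine key _ (i, j) (i + 1, j) (by simp) ?_
      ext ⟨p1, p2⟩
      simp only [up, down, vertices, Finset.mem_inter, Finset.mem_insert, Finset.mem_singleton,
        Prod.mk.injEq]
      omega

theorem adj_down_iff {i j : ℤ} {t : Tri} :
    Adj (down i j) t ↔ t = up i j ∨ t = up (i + 1) j ∨ t = up i (j + 1) := by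
  constructor
  · intro h
    have hne := h.ne
    have h2 : 1 < (vertices (down i j) ∩ vertices t).card := by unfold Adj at h; omega
    obtain ⟨⟨p1, p2⟩, hp, ⟨q1, q2⟩, hq, hpq⟩ := Finset.one_lt_card.1 h2
    obtain ⟨i', j', b⟩ := t
    cases b <;>
      simp only [up, down, vertices, Finset.mem_inter, Finset.mem_insert, Finset.mem_singleton,
        Prod.mk.injEq, ne_eq, and_true] at hp hq hpq hne ⊢ <;> omega
  · rintro (rfl | rfl | rfl) <;> apply Adj.symm <;> rw [adj_up_iff] <;> simp

theorem isLozenge_pair {s t : Tri} (h : Adj s t) : IsLozenge {s, t} := ⟨s, t, h, rfl⟩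

theorem IsLozenge.exists_adj {L : Finset Tri} (hL : IsLozenge L) {t : Tri} (ht : t ∈ L) :
    ∃ s, Adj t s ∧ L = {t, s} := by
  obtain ⟨a, b, hab, rfl⟩ := hL
  rw [Finset.mem_insert, Finset.mem_singleton] at ht
  rcases ht with rfl | rfl
  · exact ⟨b, hab, rfl⟩
  · exact ⟨a, Adj.symm hab, Finset.pair_comm _ _⟩

theorem IsTiling.insert_pair {R : Finset Tri} {T : Finset (Finset Tri)} {s t : Tri}
    (h : IsTiling (R \ {t, s}) T) (ht : t ∈ R) (hs : s ∈ R) (hts : Adj t s) :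
    IsTiling R (insert {t, s} T) := by
  refine ⟨fun L hL => ?_, fun u hu => ?_⟩
  · rcases Finset.mem_insert.1 hL with rfl | hL
    · refine ⟨isLozenge_pair hts, ?_⟩
      rw [Finset.insert_subset_iff, Finset.singleton_subset_iff]
      exact ⟨ht, hs⟩
    · exact ⟨(h.1 L hL).1, (h.1 L hL).2.trans Finset.sdiff_subset⟩
  · by_cases hut : u ∈ ({t, s} : Finset Tri)
    · refine ⟨{t, s}, ⟨Finset.mem_insert_self _ _, hut⟩, ?_⟩
      rintro L ⟨hL, huL⟩
      rcases Finset.mem_insert.1 hL with rfl | hL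
      · rfl
      · exact absurd hut (Finset.mem_sdiff.1 ((h.1 L hL).2 huL)).2
    · obtain ⟨L, ⟨hL, huL⟩, huniq⟩ := h.2 u (Finset.mem_sdiff.2 ⟨hu, hut⟩)
      refine ⟨L, ⟨Finset.mem_insert_of_mem hL, huL⟩, ?_⟩
      rintro L' ⟨hL', huL'⟩
      rcases Finset.mem_insert.1 hL' with rfl | hL'
      · exact absurd huL' hut
      · exact huniq L' ⟨hL', huL'⟩

theorem IsTiling.erase {R : Finset Tri} {T : Finset (Finset Tri)} {L : Finset Tri}
    (h : IsTiling R T) (hL : L ∈ T) : IsTiling (R \ L) (T.erase L) := by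
  refine ⟨fun L' hL' => ?_, fun u hu => ?_⟩
  · rw [Finset.mem_erase] at hL'
    refine ⟨(h.1 L' hL'.2).1, fun u hu => Finset.mem_sdiff.2 ⟨(h.1 L' hL'.2).2 hu, fun huL => ?_⟩⟩
    exact hL'.1 ((h.2 u ((h.1 L hL).2 huL)).unique ⟨hL'.2, hu⟩ ⟨hL, huL⟩)
  · rw [Finset.mem_sdiff] at hu
    obtain ⟨L', ⟨hL', huL'⟩, huniq⟩ := h.2 u hu.1
    refine ⟨L', ⟨Finset.mem_erase.2 ⟨?_, hL'⟩, huL'⟩, ?_⟩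
    · rintro rfl
      exact hu.2 huL'
    · rintro L'' ⟨h1, h2⟩
      exact huniq L'' ⟨Finset.mem_of_mem_erase h1, h2⟩

theorem IsTiling.pair_notMem {R : Finset Tri} {T : Finset (Finset Tri)} {s s' t : Tri}
    (h : IsTiling (R \ {t, s}) T) : ({t, s'} : Finset Tri) ∉ T := fun hT => by
  have := (h.1 _ hT).2 (Finset.mem_insert_self t {s'})
  simp at this

/-- Expansion of the weighted tiling count along the lozenge that covers the triangle `t`. -/
theorem weightedCount_expand {R : Finset Tri} (wt : Finset Tri → ℚ) {t : Tri} (ht : t ∈ R) :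
    weightedCount R wt =
      ∑ s ∈ R.filter (Adj t), wt {t, s} * weightedCount (R \ {t, s}) wt := by
  unfold weightedCount
  simp_rw [Finset.mul_sum]
  rw [Finset.sum_sigma']
  symm
  refine Finset.sum_bij (fun p _ => insert {t, p.1} p.2) ?_ ?_ ?_ ?_
  · rintro ⟨s, T⟩ h
    simp only [Finset.mem_sigma, Finset.mem_filter, mem_tilings] at h ⊢
    exact h.2.insert_pair ht h.1.1 h.1.2
  · rintro ⟨s, T⟩ h ⟨s', T'⟩ h' heq
    simp only [Finset.mem_sigma, Finset.mem_filter, mem_tilings] at h h' heq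
    have h1 : ({t, s} : Finset Tri) ∈ insert {t, s'} T' := heq ▸ Finset.mem_insert_self _ _
    have h2 : ({t, s} : Finset Tri) = {t, s'} :=
      (Finset.mem_insert.1 h1).resolve_right h'.2.pair_notMem
    have h3 : s = s' := by
      have : s ∈ ({t, s'} : Finset Tri) := h2 ▸ (by simp)
      rw [Finset.mem_insert, Finset.mem_singleton] at this
      exact this.resolve_left h.1.2.ne.symm
    subst h3
    have h4 : T = T' := by
      rw [← Finset.erase_insert h.2.pair_notMem, heq, Finset.erase_insert h'.2.pair_notMem]
    rw [h4]
  · intro T hT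
    rw [mem_tilings] at hT
    obtain ⟨L, ⟨hL, htL⟩, -⟩ := hT.2 t ht
    obtain ⟨s, hs, rfl⟩ := (hT.1 L hL).1.exists_adj htL
    refine ⟨⟨s, T.erase {t, s}⟩, ?_, Finset.insert_erase hL⟩
    simp only [Finset.mem_sigma, Finset.mem_filter, mem_tilings]
    exact ⟨⟨(hT.1 _ hL).2 (by simp), hs⟩, hT.erase hL⟩
  · rintro ⟨s, T⟩ h
    simp only [Finset.mem_sigma, Finset.mem_filter, mem_tilings] at h
    rw [Finset.prod_insert h.2.pair_notMem]

theorem weightedCount_empty (wt : Finset Tri → ℚ) : weightedCount ∅ wt = 1 := by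
  have h : tilings ∅ = {∅} := by
    ext T
    rw [mem_tilings, Finset.mem_singleton]
    constructor
    · intro h
      rw [Finset.eq_empty_iff_forall_notMem]
      intro L hL
      obtain ⟨⟨a, b, -, rfl⟩, h2⟩ := h.1 L hL
      exact absurd (h2 (Finset.mem_insert_self _ _)) (Finset.notMem_empty _)
    · rintro rfl
      exact ⟨by simp, by simp⟩
  simp [weightedCount, h]

theorem up_mem_trapezoid {k n : ℕ} {i j : ℤ} :
    (i, j, true) ∈ trapezoid k n ↔ 0 ≤ j ∧ j + 2 ≤ 2 * k ∧ -(j / 2) ≤ i ∧ i < n + k - j := by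
  rw [mem_trapezoid]
  simp only [vertices, InTrapezoid, zigzag, Finset.mem_insert, Finset.mem_singleton,
    forall_eq_or_imp, forall_eq]
  omega

theorem down_mem_trapezoid {k n : ℕ} {i j : ℤ} :
    (i, j, false) ∈ trapezoid k n ↔
      0 ≤ j ∧ j + 2 ≤ 2 * k ∧ -((j + 1) / 2) ≤ i ∧ i + 1 < n + k - j := by
  rw [mem_trapezoid]
  simp only [vertices, InTrapezoid, zigzag, Finset.mem_insert, Finset.mem_singleton,
    forall_eq_or_imp, forall_eq]
  omega

/-- The part of the trapezoid above height `r`, without the up-pointing triangles standing on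
height `r` at the positions in `S`. -/
noncomputable def above (k n : ℕ) (r : ℤ) (S : Finset ℤ) : Finset Tri :=
  (trapezoid k n).filter fun t => r ≤ t.2.1 ∧ (t.2.2 = true → t.2.1 = r → t.1 ∉ S)

/-- The part of the trapezoid above height `r`, without the up-pointing triangles of row `r` at
the positions to the left of `c` or in `S`, the down-pointing triangles of row `r` at the
positions to the left of `d`, and the up-pointing triangles of row `r + 1` at the positions
in `T`. -/
noncomputable def partialRow (k n : ℕ) (r : ℤ) (S : Finset ℤ) (c d : ℤ) (T : Finset ℤ) :
    Finset Tri :=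
  (trapezoid k n).filter fun t => r ≤ t.2.1 ∧
    (t.2.2 = true → (t.2.1 = r → c ≤ t.1 ∧ t.1 ∉ S) ∧ (t.2.1 = r + 1 → t.1 ∉ T)) ∧
    (t.2.2 = false → t.2.1 = r → d ≤ t.1)

section membership

variable {k n : ℕ} {r : ℤ} {S T : Finset ℤ} {c d i j : ℤ}

theorem up_mem_above : (i, j, true) ∈ above k n r S ↔
    (0 ≤ j ∧ j + 2 ≤ 2 * k ∧ -(j / 2) ≤ i ∧ i < n + k - j) ∧ r ≤ j ∧ (j = r → i ∉ S) := by
  simp [above, up_mem_trapezoid]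

theorem down_mem_above : (i, j, false) ∈ above k n r S ↔
    (0 ≤ j ∧ j + 2 ≤ 2 * k ∧ -((j + 1) / 2) ≤ i ∧ i + 1 < n + k - j) ∧ r ≤ j := by
  simp [above, down_mem_trapezoid]

theorem up_mem_partialRow : (i, j, true) ∈ partialRow k n r S c d T ↔
    (0 ≤ j ∧ j + 2 ≤ 2 * k ∧ -(j / 2) ≤ i ∧ i < n + k - j) ∧ r ≤ j ∧
      (j = r → c ≤ i ∧ i ∉ S) ∧ (j = r + 1 → i ∉ T) := by
  simp [partialRow, up_mem_trapezoid]

theorem down_mem_partialRow : (i, j, false) ∈ partialRow k n r S c d T ↔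
    (0 ≤ j ∧ j + 2 ≤ 2 * k ∧ -((j + 1) / 2) ≤ i ∧ i + 1 < n + k - j) ∧ r ≤ j ∧
      (j = r → d ≤ i) := by
  simp [partialRow, down_mem_trapezoid]

theorem ext_tri {A B : Finset Tri} (h : ∀ i j, (i, j, true) ∈ A ↔ (i, j, true) ∈ B)
    (h' : ∀ i j, (i, j, false) ∈ A ↔ (i, j, false) ∈ B) : A = B := by
  ext ⟨i, j, b⟩
  cases b
  · exact h' i j
  · exact h i j

theorem partialRow_of_mem (hc : c ∈ S) :
    partialRow k n r S c c T = partialRow k n r S (c + 1) c T := by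
  refine ext_tri (fun i j => ?_) fun i j => ?_
  · rw [up_mem_partialRow, up_mem_partialRow]
    have : i = c → i ∈ S := by rintro rfl; exact hc
    grind
  · rw [down_mem_partialRow, down_mem_partialRow]

theorem partialRow_end (hc : n + k - r ≤ c) (hd : n + k - r ≤ d + 1) :
    partialRow k n r S c d T = above k n (r + 1) T := by
  refine ext_tri (fun i j => ?_) fun i j => ?_
  · rw [up_mem_partialRow, up_mem_above]
    grind
  · rw [down_mem_partialRow, down_mem_above]
    grind

theorem partialRow_start (hc : c ≤ -(r / 2)) (hd : d ≤ -((r + 1) / 2)) :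
    partialRow k n r S c d ∅ = above k n r S := by
  refine ext_tri (fun i j => ?_) fun i j => ?_
  · rw [up_mem_partialRow, up_mem_above]
    simp only [Finset.notMem_empty, not_false_eq_true, implies_true, and_true]
    grind
  · rw [down_mem_partialRow, down_mem_above]
    grind

theorem partialRow_sdiff_up :
    partialRow k n r S c c T \ {up c r, down c r} = partialRow k n r S (c + 1) (c + 1) T := by
  refine ext_tri (fun i j => ?_) fun i j => ?_
  · simp only [Finset.mem_sdiff, up_mem_partialRow, Finset.mem_insert, Finset.mem_singleton, up,
      down, Prod.mk.injEq, and_true, Bool.true_eq_false, and_false, or_false]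
    grind
  · simp only [Finset.mem_sdiff, down_mem_partialRow, Finset.mem_insert, Finset.mem_singleton, up,
      down, Prod.mk.injEq, and_true, Bool.false_eq_true, and_false, false_or]
    grind

theorem partialRow_sdiff_right :
    partialRow k n r S c (c - 1) T \ {down (c - 1) r, up c r} =
      partialRow k n r S (c + 1) c T := by
  refine ext_tri (fun i j => ?_) fun i j => ?_
  · simp only [Finset.mem_sdiff, up_mem_partialRow, Finset.mem_insert, Finset.mem_singleton, up,
      down, Prod.mk.injEq, and_true, Bool.true_eq_false, and_false, false_or]
    grind
  · simp only [Finset.mem_sdiff, down_mem_partialRow, Finset.mem_insert, Finset.mem_singleton, up,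
      down, Prod.mk.injEq, and_true, Bool.false_eq_true, and_false, or_false]
    grind

theorem partialRow_sdiff_vertical :
    partialRow k n r S c (c - 1) T \ {down (c - 1) r, up (c - 1) (r + 1)} =
      partialRow k n r S c c (insert (c - 1) T) := by
  refine ext_tri (fun i j => ?_) fun i j => ?_
  · simp only [Finset.mem_sdiff, up_mem_partialRow, Finset.mem_insert, Finset.mem_singleton, up,
      down, Prod.mk.injEq, and_true, Bool.true_eq_false, and_false, false_or]
    grind
  · simp only [Finset.mem_sdiff, down_mem_partialRow, Finset.mem_insert, Finset.mem_singleton, up,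
      down, Prod.mk.injEq, and_true, Bool.false_eq_true, and_false, or_false]
    grind

end membership

section weights

theorem weight_row_pair {k : ℕ} {i i' j : ℤ} : weight k {up i j, down i' j} = 1 := by
  unfold weight
  rw [if_neg]
  rintro ⟨a, b, h, -⟩
  have h1 : up a b ∈ ({up i j, down i' j} : Finset Tri) := h ▸ (by simp)
  have h2 : down a (b - 1) ∈ ({up i j, down i' j} : Finset Tri) := h ▸ (by simp)
  simp [up, down] at h1 h2
  omega

/-- The weight of a vertical lozenge with horizontal diagonal at height `j` and position `i`. -/
def verticalWeight (k : ℕ) (j i : ℤ) : ℚ :=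
  if 1 ≤ j ∧ j + 2 ≤ 2 * k ∧ j % 2 = 0 ∧ i = -(j / 2) then 1 / 2 else 1

theorem weight_vertical {k : ℕ} {i j : ℤ} :
    weight k {down i j, up i (j + 1)} = verticalWeight k (j + 1) i := by
  unfold weight verticalWeight
  congr 1
  rw [eq_iff_iff]
  constructor
  · rintro ⟨a, b, h, h1, h2, h3⟩
    have h4 : up a b ∈ ({down i j, up i (j + 1)} : Finset Tri) := h ▸ (by simp)
    simp [up, down] at h4
    obtain ⟨rfl, rfl⟩ := h4
    simp only [OnWesternSide, zigzag, Prod.mk.injEq] at h1 h2 h3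
    omega
  · rintro h
    refine ⟨i, j + 1, ?_, ?_⟩
    · rw [Finset.pair_comm, add_sub_cancel_right]
    · simp only [OnWesternSide, zigzag, Prod.mk.injEq, and_true]
      omega

end weights

theorem det_updateRow_finset_sum {m : ℕ} {ι : Type*} (A : Matrix (Fin m) (Fin m) ℚ) (q : Fin m)
    (s : Finset ι) (f : ι → Fin m → ℚ) :
    (A.updateRow q (∑ t ∈ s, f t)).det = ∑ t ∈ s, (A.updateRow q (f t)).det :=
  Matrix.detRowAlternating.map_update_sum s q f A

section recursion

variable {k n : ℕ} {r : ℤ} {S T : Finset ℤ} {c s : ℤ}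

theorem count_matched_step (hr : 0 ≤ r) (hrk : r + 2 ≤ 2 * k) (hc : -(r / 2) ≤ c)
    (hce : c + 1 < n + k - r) (hcS : c ∉ S) :
    weightedCount (partialRow k n r S c c T) (weight k) =
      weightedCount (partialRow k n r S (c + 1) (c + 1) T) (weight k) := by
  have hmem : up c r ∈ partialRow k n r S c c T := by
    unfold up; rw [up_mem_partialRow]; grind
  have hf : (partialRow k n r S c c T).filter (Adj (up c r)) = {down c r} := by
    refine ext_tri (fun i j => ?_) fun i j => ?_
    · simp only [Finset.mem_filter, adj_up_iff, Finset.mem_singleton, down, Prod.mk.injEq,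
        Bool.true_eq_false, and_false, or_false]
    · simp only [Finset.mem_filter, adj_up_iff, Finset.mem_singleton, down, Prod.mk.injEq,
        and_true, down_mem_partialRow]
      grind
  rw [weightedCount_expand _ hmem, hf, Finset.sum_singleton, weight_row_pair, one_mul,
    partialRow_sdiff_up]

theorem count_matched_end (hr : 0 ≤ r) (hrk : r + 2 ≤ 2 * k) (hc : -(r / 2) ≤ c)
    (hce : c + 1 = n + k - r) (hcS : c ∉ S) :
    weightedCount (partialRow k n r S c c T) (weight k) = 0 := by
  have hmem : up c r ∈ partialRow k n r S c c T := by
    unfold up; rw [up_mem_partialRow]; grind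
  have hf : (partialRow k n r S c c T).filter (Adj (up c r)) = ∅ := by
    refine ext_tri (fun i j => ?_) fun i j => ?_
    · simp only [Finset.mem_filter, adj_up_iff, Finset.notMem_empty, down, Prod.mk.injEq,
        Bool.true_eq_false, and_false, or_false]
    · simp only [Finset.mem_filter, adj_up_iff, Finset.notMem_empty, down, Prod.mk.injEq,
        and_true, down_mem_partialRow]
      grind
  rw [weightedCount_expand _ hmem, hf, Finset.sum_empty]

theorem count_pending_step (hr : 0 ≤ r) (hrk : r + 2 ≤ 2 * k) (hc : -((r + 1) / 2) < c)
    (hce : c < n + k - r) (hcT : c - 1 ∉ T) :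
    weightedCount (partialRow k n r S c (c - 1) T) (weight k) =
      (if c ∈ S then 0 else weightedCount (partialRow k n r S (c + 1) c T) (weight k)) +
      if r + 3 ≤ 2 * k then verticalWeight k (r + 1) (c - 1) *
        weightedCount (partialRow k n r S c c (insert (c - 1) T)) (weight k) else 0 := by
  have hmem : down (c - 1) r ∈ partialRow k n r S c (c - 1) T := by
    unfold down; rw [down_mem_partialRow]; grind
  have hf : (partialRow k n r S c (c - 1) T).filter (Adj (down (c - 1) r)) =
      (if c ∈ S then ∅ else {up c r}) ∪ (if r + 3 ≤ 2 * k then {up (c - 1) (r + 1)} else ∅) := by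
    refine ext_tri (fun i j => ?_) fun i j => ?_
    · split_ifs with h1 h2 h2 <;>
      · simp only [Finset.mem_filter, adj_down_iff, Finset.mem_singleton, up, Prod.mk.injEq,
          and_true, up_mem_partialRow, Finset.mem_union, Finset.notMem_empty]
        grind
    · split_ifs with h1 h2 h2 <;>
      simp [Finset.mem_filter, adj_down_iff, up]
  rw [weightedCount_expand _ hmem, hf, Finset.sum_union]
  · congr 1
    · split_ifs
      · simp
      · rw [Finset.sum_singleton, partialRow_sdiff_right, Finset.pair_comm, weight_row_pair,
          one_mul]
    · split_ifs
      · rw [Finset.sum_singleton, partialRow_sdiff_vertical, weight_vertical]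
      · simp
  · split_ifs <;> simp [up]

theorem count_matched_eq_zero (hr : 0 ≤ r) (hrk : r + 2 ≤ 2 * k) (hc : -(r / 2) ≤ c)
    (hce : c < n + k - r) (hS : ∀ x ∈ S, x < c) :
    weightedCount (partialRow k n r S c c T) (weight k) = 0 := by
  obtain ⟨d, hd⟩ : ∃ d : ℕ, (d : ℤ) = n + k - r - c - 1 := ⟨_, Int.toNat_of_nonneg (by omega)⟩
  induction d generalizing c with
  | zero => exact count_matched_end hr hrk hc (by omega) fun h => (hS c h).false
  | succ d ih =>
    rw [count_matched_step hr hrk hc (by omega) fun h => (hS c h).false]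
    refine ih (by omega) (by omega) (fun x hx => ?_) (by omega)
    have := hS x hx
    omega

theorem count_matched_skip (hr : 0 ≤ r) (hrk : r + 2 ≤ 2 * k) (hc : -(r / 2) ≤ c)
    (hcs : c ≤ s) (hs : s < n + k - r) (hsS : s ∈ S) (hS : ∀ x ∈ S, x < c ∨ s ≤ x) :
    weightedCount (partialRow k n r S c c T) (weight k) =
      weightedCount (partialRow k n r S (s + 1) s T) (weight k) := by
  obtain ⟨d, hd⟩ : ∃ d : ℕ, (d : ℤ) = s - c := ⟨_, Int.toNat_of_nonneg (by omega)⟩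
  induction d generalizing c with
  | zero =>
    obtain rfl : c = s := by omega
    rw [partialRow_of_mem hsS]
  | succ d ih =>
    rw [count_matched_step hr hrk hc (by omega) fun h => by have := hS c h; omega]
    refine ih (by omega) (by omega) (fun x hx => ?_) (by omega)
    have := hS x hx
    have : x ≠ c := by rintro rfl; omega
    omega

theorem count_pending_end (hr : 0 ≤ r) (hrk : r + 2 ≤ 2 * k) (hc : -((r + 1) / 2) < c)
    (hce : c ≤ n + k - r) (hS : ∀ x ∈ S, x < c) (hT : ∀ x ∈ T, x < c - 1) :
    weightedCount (partialRow k n r S c (c - 1) T) (weight k) =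
      weightedCount (above k n (r + 1) T) (weight k) := by
  obtain ⟨d, hd⟩ : ∃ d : ℕ, (d : ℤ) = n + k - r - c := ⟨_, Int.toNat_of_nonneg (by omega)⟩
  induction d generalizing c with
  | zero => rw [partialRow_end (by omega) (by omega)]
  | succ d ih =>
    rw [count_pending_step hr hrk hc (by omega) fun h => (hT _ h).false,
      if_neg fun h => (hS c h).false,
      count_matched_eq_zero hr hrk (by omega) (by omega) hS, mul_zero, ite_self, add_zero]
    have := ih (c := c + 1) (by omega) (by omega) (fun x hx => by have := hS x hx; omega)
      (fun x hx => by have := hT x hx; omega) (by omega)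
    rwa [add_sub_cancel_right] at this

theorem count_pending_sum (hr : 0 ≤ r) (hrk : r + 3 ≤ 2 * k) (hc : -((r + 1) / 2) < c)
    (hcs : c ≤ s) (hs : s < n + k - r) (hsS : s ∈ S) (hS : ∀ x ∈ S, x < c ∨ s ≤ x)
    (hT : ∀ x ∈ T, x < c - 1) :
    weightedCount (partialRow k n r S c (c - 1) T) (weight k) =
      ∑ t ∈ Finset.Ico (c - 1) s, verticalWeight k (r + 1) t *
        weightedCount (partialRow k n r S (s + 1) s (insert t T)) (weight k) := by
  obtain ⟨d, hd⟩ : ∃ d : ℕ, (d : ℤ) = s - c := ⟨_, Int.toNat_of_nonneg (by omega)⟩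
  induction d generalizing c with
  | zero =>
    obtain rfl : c = s := by omega
    rw [count_pending_step hr (by omega) hc (by omega) fun h => (hT _ h).false, if_pos hsS,
      if_pos hrk, zero_add, partialRow_of_mem hsS]
    have : Finset.Ico (c - 1) c = {c - 1} := by ext; simp; omega
    rw [this, Finset.sum_singleton]
  | succ d ih =>
    have hcS : c ∉ S := fun h => by have := hS c h; omega
    have := ih (c := c + 1) (by omega) (by omega)
      (fun x hx => by
        have := hS x hx
        omega)
      (fun x hx => by have := hT x hx; omega) (by omega)
    rw [add_sub_cancel_right] at this
    rw [count_pending_step hr (by omega) hc (by omega) fun h => (hT _ h).false, if_neg hcS,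
      if_pos hrk, this, count_matched_skip hr (by omega) (by omega) hcs hs hsS hS]
    have h2 : Finset.Ico (c - 1) s = insert (c - 1) (Finset.Ico c s) := by
      ext; simp; omega
    rw [h2, Finset.sum_insert (by simp), add_comm]

/-- Transfer of a determinantal formula for the weighted tiling count through one row. -/
theorem count_row_eq_det {m : ℕ} {x : Fin (m + 1) → ℤ} (hx : StrictMono x) (hr : 0 ≤ r)
    (hrk : r + 2 ≤ 2 * k) (hm : m = 0 ∨ r + 3 ≤ 2 * k) (hx0 : -((r + 1) / 2) ≤ x 0)
    (hxe : x (Fin.last m) < n + k - r) {g : Fin m → ℤ → ℚ}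
    (hg : ∀ y : Fin m → ℤ, (∀ i, x i.castSucc ≤ y i ∧ y i < x i.succ) →
      weightedCount (above k n (r + 1) (Finset.univ.image y)) (weight k) =
        (Matrix.of fun i j => g j (y i)).det) :
    weightedCount (partialRow k n r (Finset.univ.image x) (x 0 + 1) (x 0) ∅) (weight k) =
      (Matrix.of fun i j => ∑ t ∈ Finset.Ico (x (Fin.castSucc i)) (x (Fin.succ i)),
        verticalWeight k (r + 1) t * g j t).det := by
  have key : ∀ (d : ℕ) (p : Fin (m + 1)), (p : ℕ) + d = m → ∀ y : Fin m → ℤ,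
      (∀ i : Fin m, i.castSucc < p → x i.castSucc ≤ y i ∧ y i < x i.succ) →
      weightedCount (partialRow k n r (Finset.univ.image x) (x p + 1) (x p)
        ((Finset.univ.filter fun i : Fin m => i.castSucc < p).image y)) (weight k) =
      (Matrix.of fun (i j : Fin m) => if i.castSucc < p then g j (y i) else
        ∑ t ∈ Finset.Ico (x i.castSucc) (x i.succ), verticalWeight k (r + 1) t * g j t).det := by
    intro d
    induction d with
    | zero =>
      intro p hp y hy
      obtain rfl : p = Fin.last m := Fin.ext (by simpa using hp)
      have hlt : ∀ i : Fin m, i.castSucc < Fin.last m := Fin.castSucc_lt_last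
      simp only [hlt, if_true, Finset.filter_true, forall_const] at hy ⊢
      rw [← hg y hy]
      have hle : x 0 ≤ x (Fin.last m) := hx.monotone (Fin.zero_le _)
      have := count_pending_end (S := Finset.univ.image x) (T := Finset.univ.image y)
        (c := x (Fin.last m) + 1) (n := n) hr hrk (by omega) (by omega)
        (by
          simp only [Finset.mem_image, Finset.mem_univ, true_and, forall_exists_index,
            forall_apply_eq_imp_iff]
          intro i
          have := hx.monotone (Fin.le_last i)
          omega)
        (by
          simp only [Finset.mem_image, Finset.mem_univ, true_and, forall_exists_index,
            forall_apply_eq_imp_iff]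
          intro i
          have := hx.monotone (Fin.le_last i.succ)
          have := (hy i).2
          omega)
      rwa [add_sub_cancel_right] at this
    | succ d ih =>
      intro p hp y hy
      obtain ⟨q, rfl⟩ : ∃ q : Fin m, p = q.castSucc :=
        ⟨⟨p, by omega⟩, Fin.ext rfl⟩
      have hle : x 0 ≤ x q.castSucc := hx.monotone (Fin.zero_le _)
      have hlt : x q.castSucc < x q.succ := hx Fin.castSucc_lt_succ
      have hlast : x q.succ ≤ x (Fin.last m) := hx.monotone (Fin.le_last _)
      have hsum := count_pending_sum (S := Finset.univ.image x)
        (T := (Finset.univ.filter fun i : Fin m => i.castSucc < q.castSucc).image y)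
        (c := x q.castSucc + 1) (s := x q.succ) (n := n) (k := k) hr
        (hm.resolve_left (by rintro rfl; exact q.elim0)) (by omega) (by omega) (by omega)
        (Finset.mem_image_of_mem _ (Finset.mem_univ _))
        (by
          simp only [Finset.mem_image, Finset.mem_univ, true_and, forall_exists_index,
            forall_apply_eq_imp_iff]
          intro i
          rcases le_or_gt i q.castSucc with h | h
          · have := hx.monotone h
            omega
          · exact Or.inr (hx.monotone (Fin.castSucc_lt_iff_succ_le.1 h)))
        (by
          simp only [Finset.mem_image, Finset.mem_filter, Finset.mem_univ, true_and,
            forall_exists_index, and_imp, forall_apply_eq_imp_iff₂]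
          intro i hi
          have h1 := (hy i hi).2
          have := hx.monotone (Fin.castSucc_lt_iff_succ_le.1 hi)
          omega)
      rw [add_sub_cancel_right] at hsum
      rw [hsum]
      have hrow : (Matrix.of fun (i j : Fin m) => if i.castSucc < q.castSucc then g j (y i) else
          ∑ t ∈ Finset.Ico (x i.castSucc) (x i.succ), verticalWeight k (r + 1) t * g j t) =
          (Matrix.of fun (i j : Fin m) => if i.castSucc < q.castSucc then g j (y i) else
          ∑ t ∈ Finset.Ico (x i.castSucc) (x i.succ), verticalWeight k (r + 1) t * g j t).updateRow
            q (∑ t ∈ Finset.Ico (x q.castSucc) (x q.succ),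
              verticalWeight k (r + 1) t • fun j => g j t) := by
        ext i j
        rw [Matrix.updateRow_apply]
        split_ifs with h
        · subst h
          simp [Finset.sum_apply]
        · rfl
      rw [hrow, det_updateRow_finset_sum]
      refine Finset.sum_congr rfl fun t ht => ?_
      rw [Finset.mem_Ico] at ht
      rw [Matrix.det_updateRow_smul]
      refine congrArg (verticalWeight k (r + 1) t * ·) ?_
      have hy' : ∀ i : Fin m, i.castSucc < q.succ → x i.castSucc ≤ Function.update y q t i ∧
          Function.update y q t i < x i.succ := by
        intro i hi
        by_cases h : i = q
        · subst h
          simpa using ht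
        · rw [Function.update_of_ne h]
          refine hy i ?_
          simp only [Fin.lt_def, Fin.val_castSucc, Fin.val_succ] at hi ⊢
          have : (i : ℕ) ≠ q := fun h' => h (Fin.ext h')
          omega
      have := ih q.succ (by simp at hp ⊢; omega) (Function.update y q t) hy'
      have himg : (Finset.univ.filter fun i : Fin m => i.castSucc < q.succ).image
          (Function.update y q t) =
          insert t ((Finset.univ.filter fun i : Fin m => i.castSucc < q.castSucc).image y) := by
        have h1 : (Finset.univ.filter fun i : Fin m => i.castSucc < q.succ) =
            insert q (Finset.univ.filter fun i : Fin m => i.castSucc < q.castSucc) := by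
          ext i
          simp only [Finset.mem_filter, Finset.mem_univ, true_and, Finset.mem_insert, Fin.lt_def,
            Fin.val_castSucc, Fin.val_succ, Fin.ext_iff]
          omega
        rw [h1, Finset.image_insert, Function.update_self]
        congr 1
        refine Finset.image_congr fun i hi => ?_
        rw [Function.update_of_ne]
        rintro rfl
        simp at hi
      rw [himg] at this
      refine this.trans (congrArg Matrix.det ?_)
      ext i j
      rw [Matrix.updateRow_apply]
      simp only [Matrix.of_apply]
      by_cases h : i = q
      · subst h
        simp
      · have : (i : ℕ) ≠ q := fun h' => h (Fin.ext h')
        have h2 : i.castSucc < q.succ ↔ i.castSucc < q.castSucc := by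
          simp only [Fin.lt_def, Fin.val_castSucc, Fin.val_succ]
          omega
        simp only [if_neg h, h2, Function.update_of_ne h]
  have := key m 0 (by simp) (fun _ => 0) (by simp)
  simpa using this

end recursion

/-- The normalized central factorial `x²(x² - 1)⋯(x² - (j-1)²) / (2j)!`. -/
def centralFactorial : ℕ → ℚ → ℚ
  | 0, _ => 1
  | j + 1, x => centralFactorial j x * (x ^ 2 - (j : ℚ) ^ 2) / ((2 * j + 1) * (2 * j + 2))

theorem centralFactorial_succ_mul (j : ℕ) (x : ℚ) :
    centralFactorial (j + 1) x * ((2 * j + 1) * (2 * j + 2)) =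
      centralFactorial j x * (x ^ 2 - (j : ℚ) ^ 2) := by
  rw [centralFactorial, div_mul_cancel₀]
  positivity

theorem centralFactorial_neg (j : ℕ) (x : ℚ) :
    centralFactorial j (-x) = centralFactorial j x := by
  induction j with
  | zero => rfl
  | succ j ih => simp [centralFactorial, ih]

theorem centralFactorial_differences (j : ℕ) (x : ℚ) :
    (centralFactorial (j + 1) (x + 1) - 2 * centralFactorial (j + 1) x +
      centralFactorial (j + 1) (x - 1) = centralFactorial j x) ∧
    x * (centralFactorial (j + 1) (x + 1) - centralFactorial (j + 1) (x - 1)) =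
      4 * (j + 1) * centralFactorial (j + 1) x + j * centralFactorial j x := by
  induction j with
  | zero => simp only [centralFactorial]; push_cast; constructor <;> ring
  | succ j ih =>
    obtain ⟨h1, h2⟩ := ih
    have e0 := centralFactorial_succ_mul j x
    have e := centralFactorial_succ_mul (j + 1) x
    have ep := centralFactorial_succ_mul (j + 1) (x + 1)
    have em := centralFactorial_succ_mul (j + 1) (x - 1)
    push_cast at *
    set A := centralFactorial (j + 1) (x + 1)
    set B := centralFactorial (j + 1) (x - 1)
    set C := centralFactorial (j + 1) x
    set D := centralFactorial j x
    have hc : ((2 * ((j : ℚ) + 1) + 1) * (2 * (j + 1) + 2)) ≠ 0 := by positivity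
    constructor
    · apply mul_right_cancel₀ hc
      linear_combination ep + em - 2 * e + (x ^ 2 - (j + 1) ^ 2 + 1) * h1 + 2 * h2 - e0
    · apply mul_right_cancel₀ hc
      linear_combination x * ep - x * em - 4 * (j + 2) * e +
        (x ^ 2 - (j + 1) ^ 2 + 1) * h2 + 2 * x ^ 2 * h1 - (j + 2) * e0

/-- The forward difference of the central factorial of the next order. -/
def centralDifference (j : ℕ) (y : ℚ) : ℚ :=
  centralFactorial (j + 1) (y + 1) - centralFactorial (j + 1) y

theorem centralDifference_sub (j : ℕ) (y : ℚ) :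
    centralDifference j (y + 1) - centralDifference j y = centralFactorial j (y + 1) := by
  have := (centralFactorial_differences j (y + 1)).1
  rw [add_sub_cancel_right] at this
  unfold centralDifference
  linarith

theorem centralDifference_zero (j : ℕ) : centralDifference j 0 = 1 / 2 * centralFactorial j 0 := by
  have := (centralFactorial_differences j 0).1
  rw [zero_sub, centralFactorial_neg, zero_add] at this
  unfold centralDifference
  rw [zero_add]
  linarith

theorem sum_Ico_int_sub {f g : ℤ → ℚ} {a b : ℤ} (hab : a ≤ b)
    (h : ∀ t, a ≤ t → t < b → f t = g (t + 1) - g t) :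
    ∑ t ∈ Finset.Ico a b, f t = g b - g a := by
  obtain ⟨d, rfl⟩ := Int.le.dest hab
  induction d with
  | zero => simp
  | succ d ih =>
    have h2 : Finset.Ico a (a + ((d + 1 : ℕ) : ℤ)) = insert (a + (d : ℤ)) (Finset.Ico a (a + d)) := by
      ext; simp; omega
    rw [h2, Finset.sum_insert (by simp), ih (by omega) fun t h1 h2 => h t h1 (by push_cast; omega),
      h _ (by omega) (by push_cast; omega)]
    push_cast
    rw [add_assoc]
    ring

theorem det_cons_one_eq_det_sub {m : ℕ} (G : Fin (m + 1) → Fin m → ℚ) :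
    (Matrix.of fun i => (Fin.cons 1 (G i) : Fin (m + 1) → ℚ)).det =
      (Matrix.of fun (i j : Fin m) => G i.succ j - G i.castSucc j).det := by
  rw [Matrix.det_eq_of_forall_row_eq_smul_add_pred
    (B := Matrix.of (Fin.cons (Fin.cons 1 (G 0))
      fun i => (Fin.cons 0 (fun j => G i.succ j - G i.castSucc j)) :
        Fin (m + 1) → Fin (m + 1) → ℚ)) (fun _ => 1)]
  · rw [Matrix.det_succ_column_zero, Fin.sum_univ_succ]
    simp [Matrix.submatrix]
  · intro j
    simp
  · intro i j
    refine Fin.cases ?_ (fun j => ?_) j <;> simp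

theorem det_centralFactorial {m : ℕ} (x : Fin m → ℚ) :
    (Matrix.of fun i j : Fin m => centralFactorial j (x i)).det =
      1 / (H₂ (2 * m) : ℚ) * ∏ i, ∏ j ∈ Finset.Ioi i, (x j ^ 2 - x i ^ 2) := by
  have hcf : ∀ (j : ℕ) (y : ℚ), centralFactorial j y = (1 / ((2 * j).factorial : ℚ)) *
      (∏ i ∈ Finset.range j, (Polynomial.X - Polynomial.C ((i : ℚ) ^ 2))).eval (y ^ 2) := by
    intro j y
    induction j with
    | zero => simp [centralFactorial]
    | succ j ih =>
      rw [centralFactorial, ih, Finset.prod_range_succ, Polynomial.eval_mul,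
        show 2 * (j + 1) = 2 * j + 1 + 1 by ring, Nat.factorial_succ, Nat.factorial_succ]
      simp only [Polynomial.eval_sub, Polynomial.eval_X, Polynomial.eval_C]
      have : ((2 * j).factorial : ℚ) ≠ 0 := by positivity
      push_cast
      field_simp
      ring
  have hH : ∀ m : ℕ, (H₂ (2 * m) : ℚ) = ∏ j : Fin m, ((2 * (j : ℕ)).factorial : ℚ) := by
    intro m
    induction m with
    | zero => simp [H₂]
    | succ m ih =>
      rw [show 2 * (m + 1) = 2 * m + 2 by ring, H₂, Fin.prod_univ_castSucc]
      push_cast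
      rw [ih]
      simp
  have hmonic : ∀ j : ℕ,
      (∏ i ∈ Finset.range j, (Polynomial.X - Polynomial.C ((i : ℚ) ^ 2))).Monic :=
    fun j => Polynomial.monic_prod_of_monic _ _ fun i _ => Polynomial.monic_X_sub_C _
  simp_rw [hcf]
  refine (Matrix.det_mul_row (fun j : Fin m => 1 / ((2 * (j : ℕ)).factorial : ℚ))
    (Matrix.of fun i j : Fin m => (∏ l ∈ Finset.range j,
      (Polynomial.X - Polynomial.C ((l : ℚ) ^ 2))).eval (x i ^ 2))).trans ?_
  rw [hH, ← Matrix.det_vandermonde, Matrix.det_eval_matrixOfPolynomials_eq_det_vandermonde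
    (fun i => x i ^ 2) (fun j : Fin m => ∏ l ∈ Finset.range j,
      (Polynomial.X - Polynomial.C ((l : ℚ) ^ 2))) _ fun j => hmonic j]
  · simp [Finset.prod_inv_distrib]
  · intro j
    rw [Polynomial.natDegree_prod_of_monic _ _ fun i _ => Polynomial.monic_X_sub_C _]
    simp only [Polynomial.natDegree_X_sub_C, Finset.sum_const, Finset.card_range, smul_eq_mul,
      mul_one]

theorem strictMono_of_interlacing {m : ℕ} {x : Fin (m + 1) → ℤ} (hx : StrictMono x)
    {y : Fin m → ℤ} (hy : ∀ i, x i.castSucc ≤ y i ∧ y i < x i.succ) : StrictMono y := by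
  intro i j hij
  have h1 : i.succ ≤ j.castSucc := Fin.castSucc_lt_iff_succ_le.1 (Fin.castSucc_lt_castSucc_iff.2 hij)
  exact (hy i).2.trans_le ((hx.monotone h1).trans (hy j).1)

theorem above_eq_empty {k n : ℕ} {r : ℤ} {S : Finset ℤ} (hr : 2 * k ≤ r + 1) :
    above k n r S = ∅ := by
  refine ext_tri (fun i j => ?_) fun i j => ?_
  · rw [up_mem_above]
    simp only [Finset.notMem_empty, iff_false]
    omega
  · rw [down_mem_above]
    simp only [Finset.notMem_empty, iff_false]
    omega

/-- The weighted tiling count above an even height is a determinant of central factorials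
provided that the one above the next height is a determinant of their differences. -/
theorem count_even_height {k n m h : ℕ} (hk : m + 1 + h = k) {x : Fin (m + 1) → ℤ}
    (hx : StrictMono x) (hxl : ∀ i, -(h : ℤ) ≤ x i) (hxu : ∀ i, x i < n + k - 2 * h)
    (hodd : ∀ y : Fin m → ℤ, StrictMono y → (∀ i, -(h : ℤ) ≤ y i) →
      (∀ i, y i < n + k - (2 * h + 1)) →
      weightedCount (above k n (2 * h + 1) (Finset.univ.image y)) (weight k) =
        (Matrix.of fun i j : Fin m => centralDifference j ((y i : ℚ) + h)).det) :
    weightedCount (above k n (2 * h) (Finset.univ.image x)) (weight k) =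
      (Matrix.of fun i j : Fin (m + 1) => centralFactorial j ((x i : ℚ) + h)).det := by
  have hx0 := hxl 0
  rw [← partialRow_start (c := -h) (d := -h) (by omega) (by omega),
    count_matched_skip (s := x 0) (by omega) (by omega) (by omega) hx0 (hxu 0)
      (Finset.mem_image_of_mem _ (Finset.mem_univ _))
      (by
        simp only [Finset.mem_image, Finset.mem_univ, true_and, forall_exists_index,
          forall_apply_eq_imp_iff]
        exact fun i => Or.inr (hx.monotone (Fin.zero_le i))),
    count_row_eq_det hx (by omega) (by omega) (by omega) (by omega) (hxu _)
      (g := fun j t => centralDifference j ((t : ℚ) + h))]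
  · rw [show (Matrix.of fun i j : Fin (m + 1) => centralFactorial j ((x i : ℚ) + h)) =
      Matrix.of fun i => (Fin.cons 1 (fun j : Fin m => centralFactorial (j + 1) ((x i : ℚ) + h)) :
        Fin (m + 1) → ℚ) by
          ext i j
          refine Fin.cases ?_ (fun j => ?_) j
          · simp [centralFactorial]
          · simp, det_cons_one_eq_det_sub fun i (j : Fin m) =>
            centralFactorial (j + 1) ((x i : ℚ) + h)]
    congr 1
    ext i j
    simp only [Matrix.of_apply]
    refine sum_Ico_int_sub (g := fun t => centralFactorial (j + 1) ((t : ℚ) + h))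
      (hx Fin.castSucc_lt_succ).le fun t _ _ => ?_
    rw [verticalWeight, if_neg (by omega), one_mul, centralDifference]
    push_cast
    rw [add_right_comm]
  · intro y hy
    refine hodd y (strictMono_of_interlacing hx hy) (fun i => ?_) fun i => ?_
    · exact (hxl _).trans (hy i).1
    · have := (hy i).2
      have := hxu i.succ
      omega

/-- The weighted tiling count above an odd height is a determinant of differences of central
factorials provided that the one above the next height is a determinant of central
factorials. -/
theorem count_odd_height {k n m h : ℕ} (hk : m + h + 1 = k) (hm : 1 ≤ m) {y : Fin m → ℤ}
    (hy : StrictMono y) (hyl : ∀ i, -(h : ℤ) ≤ y i) (hyu : ∀ i, y i < n + k - (2 * h + 1))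
    (heven : ∀ z : Fin m → ℤ, StrictMono z → (∀ i, -((h + 1 : ℕ) : ℤ) ≤ z i) →
      (∀ i, z i < n + k - 2 * (h + 1 : ℕ)) →
      weightedCount (above k n (2 * (h + 1 : ℕ)) (Finset.univ.image z)) (weight k) =
        (Matrix.of fun i j : Fin m => centralFactorial j ((z i : ℚ) + (h + 1 : ℕ))).det) :
    weightedCount (above k n (2 * h + 1) (Finset.univ.image y)) (weight k) =
      (Matrix.of fun i j : Fin m => centralDifference j ((y i : ℚ) + h)).det := by
  set x : Fin (m + 1) → ℤ := Fin.cons (-(h : ℤ) - 1) y with hxdef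
  have hx0 : x 0 = -(h : ℤ) - 1 := rfl
  have hxs : ∀ i, x (Fin.succ i) = y i := fun i => rfl
  have hx : StrictMono x := by
    rw [Fin.strictMono_iff_lt_succ]
    intro i
    rw [hxs]
    rcases Nat.exists_eq_add_of_le' hm with ⟨m, rfl⟩
    refine Fin.cases ?_ (fun i => ?_) i
    · have := hyl 0
      rw [Fin.castSucc_zero, hx0]
      omega
    · rw [← Fin.succ_castSucc, hxs]
      exact hy Fin.castSucc_lt_succ
  have hxl : ∀ i, -(h : ℤ) - 1 ≤ x i := fun i => hx0 ▸ hx.monotone (Fin.zero_le i)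
  have hxu : ∀ i, x i < n + k - (2 * h + 1) := by
    refine Fin.cases ?_ hyu
    rw [hx0]
    omega
  have habove : above k n (2 * h + 1) (Finset.univ.image y) =
      above k n (2 * h + 1) (Finset.univ.image x) := by
    refine ext_tri (fun i j => ?_) fun i j => ?_
    · rw [up_mem_above, up_mem_above]
      simp only [Finset.mem_image, Finset.mem_univ, true_and, Fin.exists_fin_succ, hx0, hxs]
      grind
    · rw [down_mem_above, down_mem_above]
  rw [habove, ← partialRow_start (c := x 0 + 1) (d := x 0) (by omega) (by omega),
    count_row_eq_det hx (by omega) (by omega) (by omega) (by omega) (hxu _)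
      (g := fun j t => centralFactorial j ((t : ℚ) + (h + 1 : ℕ)))]
  · set G : Fin m → ℤ → ℚ := fun j t =>
      if t = -(h : ℤ) - 1 then 0 else centralDifference j ((t : ℚ) + h) with hG
    have hdet := det_cons_one_eq_det_sub fun i (j : Fin m) => G j (x i)
    rw [Matrix.det_succ_row_zero, Fin.sum_univ_succ] at hdet
    have hrow : ∀ j : Fin m, G j (x 0) = 0 := fun j => by simp [hG, hx0]
    simp only [Matrix.of_apply, Fin.cons_zero, Fin.cons_succ, hrow, Fin.val_zero, pow_zero,
      mul_one, one_mul, mul_zero, zero_mul, Finset.sum_const_zero, add_zero] at hdet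
    trans (Matrix.of fun (i j : Fin m) => G j (x i.succ) - G j (x i.castSucc)).det
    · congr 1
      ext i j
      simp only [Matrix.of_apply]
      refine sum_Ico_int_sub (g := G j) (hx Fin.castSucc_lt_succ).le fun t ht _ => ?_
      have htl := (hxl _).trans ht
      have h1 : t + 1 ≠ -(h : ℤ) - 1 := by omega
      simp only [hG, if_neg h1]
      by_cases h2 : t = -(h : ℤ) - 1
      · rw [if_pos h2, sub_zero, verticalWeight, if_pos (by omega), h2]
        push_cast
        rw [show (-(h : ℚ) - 1 + (h + 1)) = 0 by ring, show (-(h : ℚ) - 1 + 1 + h) = 0 by ring,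
          centralDifference_zero]
      · rw [if_neg h2, verticalWeight, if_neg (by omega), one_mul]
        push_cast
        rw [add_right_comm, centralDifference_sub, add_assoc]
    · rw [← hdet]
      congr 1
      ext i j
      have h1 : y i ≠ -(h : ℤ) - 1 := by have := hyl i; omega
      simp [hG, hxs, h1]
  · intro z hz
    have := heven z (strictMono_of_interlacing hx hz) (fun i => ?_) fun i => ?_
    · rw [← this]
      push_cast
      rw [mul_add, mul_one, add_assoc]
      rfl
    · have := (hxl _).trans (hz i).1
      push_cast
      omega
    · have := (hz i).2
      have := hxu i.succ
      push_cast
      omega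

theorem count_above_even {k n : ℕ} (m : ℕ) : ∀ h : ℕ, m + 1 + h = k →
    ∀ x : Fin (m + 1) → ℤ, StrictMono x → (∀ i, -(h : ℤ) ≤ x i) →
      (∀ i, x i < n + k - 2 * h) →
    weightedCount (above k n (2 * h) (Finset.univ.image x)) (weight k) =
      (Matrix.of fun i j : Fin (m + 1) => centralFactorial j ((x i : ℚ) + h)).det := by
  induction m with
  | zero =>
    intro h hk x hx hxl hxu
    refine count_even_height hk hx hxl hxu fun y _ _ _ => ?_
    rw [above_eq_empty (by omega), weightedCount_empty, Matrix.det_fin_zero]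
  | succ m ih =>
    intro h hk x hx hxl hxu
    refine count_even_height hk hx hxl hxu fun y hy hyl hyu => ?_
    exact count_odd_height (by omega) (by omega) hy hyl hyu (ih (h + 1) (by omega))

theorem quarteredHexagon_eq_above {k n : ℕ} (a : Fin k → ℕ) :
    quarteredHexagon k n a = above k n 0 (Finset.univ.image fun i => (a i : ℤ) - 1) := by
  refine ext_tri (fun i j => ?_) fun i j => ?_
  · rw [up_mem_above, quarteredHexagon, Finset.mem_sdiff, up_mem_trapezoid]
    simp only [Finset.mem_image, Finset.mem_univ, true_and, up, Prod.mk.injEq, and_true]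
    grind
  · rw [down_mem_above, quarteredHexagon, Finset.mem_sdiff, down_mem_trapezoid]
    simp only [Finset.mem_image, Finset.mem_univ, up, Prod.mk.injEq,
      Bool.true_eq_false, and_false, exists_false, not_false_eq_true, and_true]
    omega

end Lozenge

theorem mainTheorem7 (k n : ℕ) (hk : 1 ≤ k) (a : Fin k → ℕ) (ha : StrictMono a)
    (ha_pos : ∀ i, 1 ≤ a i) (ha_le : ∀ i, a i ≤ n + k) :
    Lozenge.weightedCount (Lozenge.quarteredHexagon k n a) (Lozenge.weight k) =
      1 / (Lozenge.H₂ (2 * k) : ℚ) *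
        (∏ i : Fin k, ∏ j ∈ Finset.Ioi i, ((a j : ℚ) - (a i : ℚ))) *
        (∏ i : Fin k, ∏ j ∈ Finset.Ioi i, ((a i : ℚ) + (a j : ℚ) - 2)) := by
  obtain ⟨m, rfl⟩ := Nat.exists_eq_add_of_le' hk
  have h := Lozenge.count_above_even (k := m + 1) (n := n) m 0 rfl (fun i => (a i : ℤ) - 1)
    (fun i j hij => by have := ha hij; simp only; omega)
    (fun i => by have := ha_pos i; omega)
    (fun i => by have := ha_le i; omega)
  rw [Nat.cast_zero, mul_zero] at h
  rw [Lozenge.quarteredHexagon_eq_above, h,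
    Lozenge.det_centralFactorial fun i => (((a i : ℤ) - 1 : ℤ) : ℚ) + (0 : ℕ), mul_assoc]
  simp_rw [← Finset.prod_mul_distrib]
  congr 1
  refine Finset.prod_congr rfl fun i _ => Finset.prod_congr rfl fun j _ => ?_
  push_cast
  ring
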